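/- Let $\eta$ be the law of an i.i.d. family $\omega=(\omega_i)_{i\in\mathbb Z}$ of random variables with values in $[0,1]$ (the environment), and put $\rho_i=(1-\omega_i)/\omega_i$. Assume that 1. there is an $\varepsilon_0>0$ with $\eta(\varepsilon_0\le\omega_0\le 1-\varepsilon_0)=1$; 2. $\int \log\rho_0\,d\eta=0$ (the recurrent case); 3. $\operatorname{Var}_\eta(\log\rho_0)>0$. Given $\omega$, let $P_\omega$ be the law of the Markov chain $(S_n)_{n\ge0}$ on $\mathbb Z$ with $S_0=0$ which jumps from $i$ to $i+1$ with probability $\omega_i$ and from $i$ to $i-1$ with probability $1-\omega_i$. Let $\mathbb P(\cdot)=\int P_\omega(\cdot)\,\eta(d\omega)$ be the annealed law, with expectation $\mathbb E$, and let $\tau_1=\inf\{n>0: S_n=1\}$ (with $\tau_1^\alpha e^{-r\tau_1}:=0$ if $\tau_1=\infty$). Then for every real $\alpha>0$, $$\mathbb E\left(\tau_1^{\alpha}e^{-r\tau_1}\right)=\left(\frac1r\right)^{\alpha+o(1)},\qquad r\to0^+ ;$$ that is, there is a function $o:\mathbb R\to\mathbb R$ with $o(r)\to0$ as $r\to0^+$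 such that, for all sufficiently small $r>0$, the expectation exists, is finite, and equals $(1/r)^{\alpha+o(r)}$. -/

import Mathlib

open MeasureTheory ProbabilityTheory Filter Topology

noncomputable section

namespace RWRE

/-- An environment: a family `(ω_i)` of numbers in `[0, 1]` indexed by `i ∈ ℤ`. -/
abbrev Env : Type := ℤ → unitInterval

/-- The one-step law of the walk at site `i`: it jumps to `i + 1` with probability `ω_i` and to
`i - 1` with probability `1 - ω_i`. -/
def stepLaw (ω : Env) (i : ℤ) : Measure ℤ :=
  ENNReal.ofReal (ω i : ℝ) • Measure.dirac (i + 1) +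
    ENNReal.ofReal (1 - (ω i : ℝ)) • Measure.dirac (i - 1)

instance (ω : Env) (i : ℤ) : IsProbabilityMeasure (stepLaw ω i) := ⟨by
  simp only [stepLaw, Measure.add_apply, Measure.smul_apply, measure_univ, smul_eq_mul, mul_one]
  rw [← ENNReal.ofReal_add (ω i).2.1 (sub_nonneg.2 (ω i).2.2)]
  simp⟩

/-- The transition kernel of the walk in the environment `ω`. -/
def stepKernel (ω : Env) : Kernel ℤ ℤ := Kernel.ofFunOfCountable (stepLaw ω)

instance (ω : Env) : IsMarkovKernel (stepKernel ω) :=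
  ⟨fun i => inferInstanceAs (IsProbabilityMeasure (stepLaw ω i))⟩

/-- The law of position `n + 1` given the path up to time `n`: it depends on the position at
time `n` only. -/
def pathKernel (ω : Env) (n : ℕ) : Kernel (Finset.Iic n → ℤ) ℤ :=
  (stepKernel ω).comap (fun h => h ⟨n, Finset.mem_Iic.2 le_rfl⟩) (measurable_pi_apply _)

instance (ω : Env) (n : ℕ) : IsMarkovKernel (pathKernel ω n) := by
  unfold pathKernel; infer_instance

/-- The quenched law `P_ω^x` on paths `(S_n)_{n ∈ ℕ}`: the law of the Markov chain with transition
kernel `stepKernel ω` started at `S_0 = x`. -/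
def quenchedLaw (ω : Env) (x : ℤ) : Measure (ℕ → ℤ) :=
  Kernel.trajMeasure (X := fun _ => ℤ) (Measure.dirac x) (pathKernel ω)

instance (ω : Env) (x : ℤ) : IsProbabilityMeasure (quenchedLaw ω x) := by
  unfold quenchedLaw; infer_instance

theorem quenchedLaw_start (ω : Env) (x y : ℤ) :
    quenchedLaw ω x {S | S 0 = y} = if x = y then 1 else 0 := by
  have hmap : (quenchedLaw ω x).map (Preorder.frestrictLe (π := fun _ => ℤ) 0) =
      (Measure.dirac x).map (MeasurableEquiv.piUnique (fun _ : Finset.Iic 0 => ℤ)).symm := by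
    rw [quenchedLaw, Kernel.trajMeasure, Measure.map_comp _ _ (by fun_prop),
      Kernel.traj_map_frestrictLe, Kernel.partialTraj_self]
    exact Measure.id_comp
  have h := congrArg (fun m => m {h | h ⟨0, Finset.mem_Iic.2 le_rfl⟩ = y}) hmap
  rw [Measure.map_apply (by fun_prop) (measurableSet_eq_fun (by fun_prop) (by fun_prop)),
    Measure.map_apply (by fun_prop) (measurableSet_eq_fun (by fun_prop) (by fun_prop)),
    Measure.dirac_apply] at h
  refine Eq.trans h ?_
  simp only [Set.indicator, Set.mem_preimage, Set.mem_ofPred_eq, Pi.one_apply]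
  rfl

theorem quenchedLaw_step (ω : Env) (x : ℤ) (p : ℕ → ℤ) (n : ℕ) :
    quenchedLaw ω x {S | ∀ i ≤ n + 1, S i = p i} =
      quenchedLaw ω x {S | ∀ i ≤ n, S i = p i} * stepLaw ω (p n) {p (n + 1)} := by
  have h := Kernel.map_frestrictLe_trajMeasure_compProd_eq_map_trajMeasure
    (X := fun _ => ℤ) (μ₀ := Measure.dirac x) (κ := pathKernel ω) (a := n)
  have h' := congrArg
    (fun m => m ({fun i : Finset.Iic n => p i} ×ˢ {p (n + 1)})) h
  have hm : MeasurableSet ({fun i : Finset.Iic n => p i} : Set (Finset.Iic n → ℤ)) :=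
    measurableSet_singleton _
  rw [Measure.compProd_apply_prod hm (measurableSet_singleton _),
    Measure.map_apply (by fun_prop) (hm.prod (measurableSet_singleton _)),
    lintegral_singleton, Measure.map_apply (by fun_prop) hm] at h'
  have e1 : {S : ℕ → ℤ | ∀ i ≤ n + 1, S i = p i} =
      (fun S : ℕ → ℤ => (Preorder.frestrictLe (π := fun _ => ℤ) n S, S (n + 1))) ⁻¹'
        ({fun i : Finset.Iic n => p i} ×ˢ {p (n + 1)}) := by
    ext S
    simp only [Set.mem_ofPred_eq, Set.mem_preimage, Set.mem_prod, Set.mem_singleton_iff, funext_iff,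
      Subtype.forall, Finset.mem_Iic, Preorder.frestrictLe_apply]
    constructor
    · exact fun H => ⟨fun i hi => H i (by omega), H _ le_rfl⟩
    · rintro ⟨H1, H2⟩ i hi
      rcases Nat.lt_or_ge n i with h | h
      · obtain rfl : i = n + 1 := by omega
        exact H2
      · exact H1 i h
  have e2 : {S : ℕ → ℤ | ∀ i ≤ n, S i = p i} =
      Preorder.frestrictLe (π := fun _ => ℤ) n ⁻¹' {fun i : Finset.Iic n => p i} := by
    ext S
    simp [funext_iff]
  rw [e1, e2, mul_comm]
  exact h'.symm

theorem measurable_stepLaw_singleton (i j : ℤ) :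
    Measurable fun ω : Env => stepLaw ω i {j} := by
  simp only [stepLaw, Measure.add_apply, Measure.smul_apply, smul_eq_mul]
  fun_prop

theorem measurable_quenchedLaw_path (x : ℤ) (p : ℕ → ℤ) (n : ℕ) :
    Measurable fun ω : Env => quenchedLaw ω x {S | ∀ i ≤ n, S i = p i} := by
  induction n with
  | zero => simp [quenchedLaw_start]
  | succ n ih =>
    simp only [quenchedLaw_step]
    exact ih.mul (measurable_stepLaw_singleton _ _)

/-- The quenched law is a measurable function of the environment. -/
theorem measurable_quenchedLaw (x : ℤ) : Measurable fun ω : Env => quenchedLaw ω x := by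
  refine Measurable.measure_of_isPiSystem_of_isProbabilityMeasure
    (generateFrom_measurableCylinders (α := fun _ : ℕ => ℤ)).symm
    isPiSystem_measurableCylinders fun s hs => ?_
  rw [measurableCylinders_nat] at hs
  simp only [Set.mem_iUnion, Set.mem_singleton_iff] at hs
  obtain ⟨n, A, -, rfl⟩ := hs
  have e : cylinder (Finset.Iic n) A = ⋃ h : A, {S : ℕ → ℤ | ∀ i ≤ n, S i =
      (fun j => if hj : j ∈ Finset.Iic n then h.1 ⟨j, hj⟩ else 0) i} := by
    ext S
    simp only [mem_cylinder, Set.mem_iUnion, Set.mem_ofPred_eq]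
    constructor
    · intro H
      refine ⟨⟨_, H⟩, fun i hi => ?_⟩
      simp [hi]
    · rintro ⟨⟨h, hA⟩, H⟩
      convert hA using 1
      ext ⟨i, hi⟩
      simpa [Finset.mem_Iic.1 hi] using H i (Finset.mem_Iic.1 hi)
  have hd : Pairwise fun h h' : A => Disjoint
      {S : ℕ → ℤ | ∀ i ≤ n, S i =
        (fun j => if hj : j ∈ Finset.Iic n then h.1 ⟨j, hj⟩ else 0) i}
      {S : ℕ → ℤ | ∀ i ≤ n, S i =
        (fun j => if hj : j ∈ Finset.Iic n then h'.1 ⟨j, hj⟩ else 0) i} := by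
    intro h h' hne
    refine Set.disjoint_left.2 fun S H H' => hne (Subtype.ext (funext fun ⟨i, hi⟩ => ?_))
    have := (H i (Finset.mem_Iic.1 hi)).symm.trans (H' i (Finset.mem_Iic.1 hi))
    simpa [Finset.mem_Iic.1 hi] using this
  have hms : ∀ p : ℕ → ℤ, MeasurableSet {S : ℕ → ℤ | ∀ i ≤ n, S i = p i} := fun p => by
    measurability
  simp only [e]
  have : ∀ ω : Env, _ := fun ω => measure_iUnion (μ := quenchedLaw ω x) hd fun h => hms _
  simp only [this]
  exact Measurable.tsum fun h => measurable_quenchedLaw_path x _ n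

/-- The annealed law `ℙ(·) = ∫ P_ω(·) η(dω)` of the walk started at `0`, where `η` is the law of
the environment. -/
def annealedLaw (η : Measure Env) : Measure (ℕ → ℤ) :=
  η.bind fun ω => quenchedLaw ω 0

theorem annealedLaw_apply (η : Measure Env) {A : Set (ℕ → ℤ)} (hA : MeasurableSet A) :
    annealedLaw η A = ∫⁻ ω, quenchedLaw ω 0 A ∂η :=
  Measure.bind_apply hA (measurable_quenchedLaw 0).aemeasurable

/-- `log ρ_i = log ((1 - ω_i) / ω_i)`. -/
def logRho (i : ℤ) (ω : Env) : ℝ := Real.log ((1 - (ω i : ℝ)) / (ω i : ℝ))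

/-- The hitting time `τ_a = inf {n > 0 : S_n = a}` of a path, which is `∞` if `a` is never hit. -/
def hittingTime (a : ℤ) (S : ℕ → ℤ) : ℕ∞ := ⨅ (n : ℕ) (_ : 0 < n ∧ S n = a), (n : ℕ∞)

/-- The value `t ^ α * e ^ (-r t)`, with the value `0` (the limit at infinity) for `t = ∞`. -/
def powExp (α r : ℝ) (t : ℕ∞) : ℝ :=
  if t = ⊤ then 0 else (t.toNat : ℝ) ^ α * Real.exp (-r * t.toNat)

end RWRE

end

/-!
The upper bound is the maximum of `x ^ α * exp (-r * x)`, which is at most `(α / r) ^ α`.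

For the lower bound, the quenched Laplace transform of `τ₁` is `1 / (1 + X 0)`, where `X` is a
nonnegative solution of a Riccati recursion with coefficients `ρ₋ₙ`. Let `R = r ^ (1 - δ)`. If the
potential has a valley of depth about `log (1 / R)` to the left of the origin, then bounding `X 0`
along the two slopes of the valley shows that the transform is close to `1` at `r` but bounded away
from `1` at `R`. Hence `τ₁` is at least of order `1 / R` with probability bounded below, and it is
not much larger than `1 / r`, which gives a quenched expectation of order at least `R ^ (-α)`.

By the central limit theorem, the potential rises (or falls) by `√M` over a block of length `M` with
probability at least some `p > 0` for all large `M`. The valley consists of order `log (1 / R) / √M`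
blocks, so that its probability is at least of order `R ^ δ` when `M` is large. Therefore the
annealed expectation is at least of order `r ^ ((1 - δ) * (δ - α))`, and `δ` is arbitrary.
-/

noncomputable section

namespace RWRE

/-! ### Valleys and the Riccati recursion -/

section AffineRecursion

variable {R : Type*} [CommSemiring R] [PartialOrder R] [IsOrderedRing R]

theorem le_sum_prod_mul_add_prod_mul {v b c : ℕ → R} {K : ℕ} (hc : ∀ i < K, 0 ≤ c i)
    (hv : ∀ i < K, v i ≤ b i + c i * v (i + 1)) :
    v 0 ≤ ∑ i ∈ Finset.range K, (∏ k ∈ Finset.range i, c k) * b i +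
      (∏ i ∈ Finset.range K, c i) * v K := by
  induction K with
  | zero => simp
  | succ K ih =>
    have hprod : 0 ≤ ∏ i ∈ Finset.range K, c i :=
      Finset.prod_nonneg fun i hi => hc i ((Finset.mem_range.1 hi).trans K.lt_succ_self)
    calc v 0 ≤ ∑ i ∈ Finset.range K, (∏ k ∈ Finset.range i, c k) * b i +
          (∏ i ∈ Finset.range K, c i) * v K := ih (fun i hi => hc i (by omega))
            fun i hi => hv i (by omega)
      _ ≤ ∑ i ∈ Finset.range K, (∏ k ∈ Finset.range i, c k) * b i +
          (∏ i ∈ Finset.range K, c i) * (b K + c K * v (K + 1)) := by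
        gcongr
        exact hv K K.lt_succ_self
      _ = _ := by
        rw [Finset.sum_range_succ, Finset.prod_range_succ]
        ring

theorem le_geom_sum_mul_add_pow_mul {v : ℕ → R} {b c : R} {K : ℕ} (hc : 0 ≤ c)
    (hv : ∀ i < K, v i ≤ b + c * v (i + 1)) :
    v 0 ≤ (∑ i ∈ Finset.range K, c ^ i) * b + c ^ K * v K := by
  simpa only [Finset.prod_const, Finset.card_range, ← Finset.sum_mul] using
    le_sum_prod_mul_add_prod_mul (fun _ _ => hc) hv

end AffineRecursion

section GeomSum

variable {R : Type*} [CommRing R] [LinearOrder R] [IsStrictOrderedRing R]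

theorem geom_sum_le_two {c : R} (hc : 0 ≤ c) (hc2 : 2 * c ≤ 1) (K : ℕ) :
    ∑ i ∈ Finset.range K, c ^ i ≤ 2 := by
  have h := geom_sum_mul c K
  have hpow : 0 ≤ c ^ K := pow_nonneg hc K
  have hsum : 0 ≤ ∑ i ∈ Finset.range K, c ^ i := Finset.sum_nonneg fun i _ => pow_nonneg hc i
  nlinarith

theorem geom_sum_le_pow {c : R} (hc : 2 ≤ c) (K : ℕ) :
    ∑ i ∈ Finset.range K, c ^ i ≤ c ^ K := by
  have h := geom_sum_mul c K
  have hsum : 0 ≤ ∑ i ∈ Finset.range K, c ^ i :=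
    Finset.sum_nonneg fun i _ => pow_nonneg (by linarith) i
  nlinarith

end GeomSum

/-- The sum of the terms of `z` over the `j`-th block of length `M`, blocks being numbered from
`0`. -/
def blockSum (z : ℕ → ℝ) (M j : ℕ) : ℝ := ∑ i ∈ Finset.range M, z (j * M + i)

theorem blockSum_neg (z : ℕ → ℝ) (M j : ℕ) : blockSum (-z) M j = -blockSum z M j := by
  simp [blockSum]

/-- A valley of a potential with decrements `z`: the potential falls by an amount in `[a, A]` over
each of the first `K` blocks of length `M`, and then rises by at least `a` over each of the next
`3 * K` blocks. -/
structure IsValley (z : ℕ → ℝ) (a A : ℝ) (M K : ℕ) : Prop where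
  descent : ∀ j < K, blockSum z M j ∈ Set.Icc a A
  ascent : ∀ j, K ≤ j → j < 4 * K → blockSum z M j ≤ -a

theorem le_block_of_le_affine {v z : ℕ → ℝ} {b L : ℝ} (hb : 0 ≤ b) (hz : ∀ n, z n ≤ L)
    (hv : ∀ n, v n ≤ b + Real.exp (z n) * v (n + 1)) (M j : ℕ) :
    v (j * M) ≤ b * ∑ i ∈ Finset.range M, Real.exp L ^ i +
      Real.exp (blockSum z M j) * v ((j + 1) * M) := by
  have h := le_sum_prod_mul_add_prod_mul (v := fun i => v (j * M + i)) (b := fun _ => b)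
    (c := fun i => Real.exp (z (j * M + i))) (K := M) (fun _ _ => (Real.exp_pos _).le)
    fun i _ => hv (j * M + i)
  rw [← Real.exp_sum, ← Finset.sum_mul, mul_comm _ b] at h
  rw [add_one_mul]
  refine h.trans ?_
  simp only [blockSum]
  gcongr with i _
  calc ∏ k ∈ Finset.range i, Real.exp (z (j * M + k)) ≤ ∏ _k ∈ Finset.range i, Real.exp L := by
        gcongr
        exact hz _
    _ = Real.exp L ^ i := by simp

/-- A nonnegative solution of the recursion satisfied by `X n = 1 / φ n - 1`, where `φ n` is the
Laplace transform at `log (1 + s)` of the passage time from `-n` to `1 - n` and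
`z n = log ρ₋ₙ`. -/
structure IsRiccati (z : ℕ → ℝ) (s : ℝ) (X : ℕ → ℝ) : Prop where
  nonneg : ∀ n, 0 ≤ X n
  eq : ∀ n, X n = s * (1 + Real.exp (z n)) + Real.exp (z n) * (X (n + 1) / (1 + X (n + 1)))

namespace IsRiccati

variable {z X : ℕ → ℝ} {s L a A : ℝ} {M K : ℕ}

theorem le_const (h : IsRiccati z s X) (hz : ∀ n, z n ≤ L) (hs : 0 ≤ s) (n : ℕ) :
    X n ≤ s * (1 + Real.exp L) + Real.exp L := by
  have h1 : X (n + 1) / (1 + X (n + 1)) ≤ 1 :=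
    div_le_one_of_le₀ (by linarith) (by linarith [h.nonneg (n + 1)])
  calc X n ≤ s * (1 + Real.exp (z n)) + Real.exp (z n) * 1 := by rw [h.eq n]; gcongr
    _ ≤ s * (1 + Real.exp L) + Real.exp L := by rw [mul_one]; gcongr <;> exact hz n

theorem le_affine (h : IsRiccati z s X) (hz : ∀ n, z n ≤ L) (hs : 0 ≤ s) (n : ℕ) :
    X n ≤ s * (1 + Real.exp L) + Real.exp (z n) * X (n + 1) := by
  have h1 : X (n + 1) / (1 + X (n + 1)) ≤ X (n + 1) :=
    div_le_self (h.nonneg _) (by linarith [h.nonneg (n + 1)])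
  rw [h.eq n]
  gcongr
  exact hz n

theorem le_self (h : IsRiccati z s X) (hs : 0 ≤ s) (n : ℕ) : s ≤ X n := by
  have h0 := h.nonneg (n + 1)
  have h1 : 0 ≤ s * Real.exp (z n) + Real.exp (z n) * (X (n + 1) / (1 + X (n + 1))) := by
    positivity
  linarith [h.eq n]

theorem inv_le_affine (h : IsRiccati z s X) (hz : ∀ n, -z n ≤ L) (hs : 0 < s) (n : ℕ) :
    (X n)⁻¹ ≤ Real.exp L + Real.exp (-z n) * (X (n + 1))⁻¹ := by
  have h0 : 0 < X (n + 1) := hs.trans_le (h.le_self hs.le _)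
  have h1 : Real.exp (z n) * (X (n + 1) / (1 + X (n + 1))) ≤ X n := by
    rw [h.eq n]
    exact le_add_of_nonneg_left (by positivity)
  calc (X n)⁻¹ ≤ (Real.exp (z n) * (X (n + 1) / (1 + X (n + 1))))⁻¹ := by gcongr
    _ = Real.exp (-z n) + Real.exp (-z n) * (X (n + 1))⁻¹ := by
      rw [Real.exp_neg]
      field_simp
      ring
    _ ≤ Real.exp L + Real.exp (-z n) * (X (n + 1))⁻¹ := by gcongr; exact hz n

theorem le_of_isValley (h : IsRiccati z s X) (hz : ∀ n, z n ≤ L) (hs : 0 ≤ s)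
    (hV : IsValley z a A M K) (ha : 2 * Real.exp (-a) ≤ 1) (hA : 2 ≤ Real.exp A) :
    X 0 ≤ Real.exp A ^ K * (3 * (s * (1 + Real.exp L) * ∑ i ∈ Finset.range M, Real.exp L ^ i) +
      Real.exp (-a) ^ (3 * K) * (s * (1 + Real.exp L) + Real.exp L)) := by
  set D := s * (1 + Real.exp L) * ∑ i ∈ Finset.range M, Real.exp L ^ i with hD
  have hD0 : 0 ≤ D := by positivity
  have hblock (j : ℕ) : X (j * M) ≤ D + Real.exp (blockSum z M j) * X ((j + 1) * M) :=
    le_block_of_le_affine (by positivity) hz (h.le_affine hz hs) M j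
  have hdescent : X 0 ≤ Real.exp A ^ K * D + Real.exp A ^ K * X (K * M) := by
    have h1 := le_geom_sum_mul_add_pow_mul (v := fun j => X (j * M)) (b := D) (K := K)
      (Real.exp_pos A).le fun j hj => (hblock j).trans <| by
        have := h.nonneg ((j + 1) * M)
        gcongr
        exact (hV.descent j hj).2
    rw [zero_mul] at h1
    refine h1.trans ?_
    gcongr
    exact geom_sum_le_pow hA K
  have hascent : X (K * M) ≤ 2 * D + Real.exp (-a) ^ (3 * K) * X ((K + 3 * K) * M) := by
    have h1 := le_geom_sum_mul_add_pow_mul (v := fun j => X ((K + j) * M)) (b := D) (K := 3 * K)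
      (Real.exp_pos (-a)).le fun j hj => (hblock (K + j)).trans <| by
        have := h.nonneg ((K + j + 1) * M)
        rw [← add_assoc]
        gcongr
        exact hV.ascent (K + j) (by omega) (by omega)
    refine h1.trans ?_
    gcongr
    exact geom_sum_le_two (Real.exp_pos _).le ha _
  calc X 0 ≤ Real.exp A ^ K * D + Real.exp A ^ K *
        (2 * D + Real.exp (-a) ^ (3 * K) * (s * (1 + Real.exp L) + Real.exp L)) := by
        refine hdescent.trans ?_
        gcongr
        refine hascent.trans ?_
        gcongr
        exact h.le_const hz hs _
    _ = _ := by ring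

theorem inv_le_of_isValley (h : IsRiccati z s X) (hz : ∀ n, -z n ≤ L) (hs : 0 < s)
    (hV : IsValley z a A M K) (ha : 2 * Real.exp (-a) ≤ 1) (hK : Real.exp (-a) ^ K ≤ s) :
    (X 0)⁻¹ ≤ 2 * (Real.exp L * ∑ i ∈ Finset.range M, Real.exp L ^ i) + 1 := by
  set D := Real.exp L * ∑ i ∈ Finset.range M, Real.exp L ^ i with hD
  have hD0 : 0 ≤ D := by positivity
  have hblock (j : ℕ) : (X (j * M))⁻¹ ≤
      D + Real.exp (blockSum (-z) M j) * (X ((j + 1) * M))⁻¹ :=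
    le_block_of_le_affine (v := fun n => (X n)⁻¹) (Real.exp_pos L).le hz
      (h.inv_le_affine hz hs) M j
  have h1 := le_geom_sum_mul_add_pow_mul (v := fun j => (X (j * M))⁻¹) (b := D) (K := K)
    (Real.exp_pos (-a)).le fun j hj => (hblock j).trans <| by
      have := h.nonneg ((j + 1) * M)
      rw [blockSum_neg]
      gcongr
      exact (hV.descent j hj).1
  rw [zero_mul] at h1
  refine h1.trans ?_
  gcongr
  · exact geom_sum_le_two (Real.exp_pos _).le ha _
  · rw [← div_eq_mul_inv]
    exact (div_le_one (hs.trans_le (h.le_self hs.le _))).2 (hK.trans (h.le_self hs.le _))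

end IsRiccati

/-- A `[0, 1]`-valued solution, equal to `1` at `0`, of the equation satisfied by the Laplace
transforms at `log (1 + s)` of the hitting times of `0` for the walk on `ℕ` which jumps from
`n + 1` to `n` with probability `w n` and to `n + 2` with probability `1 - w n`. -/
structure IsHittingTransform (w : ℕ → ℝ) (s : ℝ) (U : ℕ → ℝ) : Prop where
  mem_unitInterval : ∀ n, U n ∈ Set.Icc 0 1
  zero : U 0 = 1
  eq : ∀ n, (1 + s) * U (n + 1) = w n * U n + (1 - w n) * U (n + 2)

namespace IsHittingTransform

variable {U w : ℕ → ℝ} {s : ℝ}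

theorem pos (h : IsHittingTransform w s U) (hs : 0 < s) (hw : ∀ n, w n ∈ Set.Ioo 0 1) (n : ℕ) :
    0 < U n := by
  induction n with
  | zero => simp [h.zero]
  | succ n ih =>
    have h1 : 0 < w n * U n := mul_pos (hw n).1 ih
    have h2 : 0 ≤ (1 - w n) * U (n + 2) :=
      mul_nonneg (by linarith [(hw n).2]) (h.mem_unitInterval _).1
    exact pos_of_mul_pos_right (by linarith [h.eq n]) (by linarith : 0 ≤ 1 + s)

theorem mul_le_of_le (h : IsHittingTransform w s U) (hs : 0 < s) (hw : ∀ n, w n ∈ Set.Ioo 0 1)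
    {n : ℕ} (hn : U n ≤ U (n + 1)) : (1 + s) * U (n + 1) ≤ U (n + 2) := by
  have h0 := hw n
  have h1 : w n * U n ≤ w n * ((1 + s) * U (n + 1)) := by
    have := h0.1.le
    gcongr
    nlinarith [h.pos hs hw (n + 1)]
  exact le_of_mul_le_mul_left (by linarith [h.eq n] : (1 - w n) * _ ≤ (1 - w n) * _)
    (by linarith [h0.2])

/-- Once `U` increases, it grows geometrically, which boundedness forbids. -/
theorem antitone (h : IsHittingTransform w s U) (hs : 0 < s) (hw : ∀ n, w n ∈ Set.Ioo 0 1) :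
    Antitone U := by
  refine antitone_nat_of_succ_le fun n => ?_
  by_contra! hn
  have hmono (k : ℕ) : U (n + k) ≤ U (n + k + 1) := by
    induction k with
    | zero => exact hn.le
    | succ k ih =>
      have h1 : U (n + k + 1) ≤ (1 + s) * U (n + k + 1) := by
        nlinarith [h.pos hs hw (n + k + 1)]
      exact h1.trans (h.mul_le_of_le hs hw ih)
  have htop : Tendsto (fun k => U (n + k + 1)) atTop atTop :=
    tendsto_atTop_of_geom_le (h.pos hs hw _) (by linarith : 1 < 1 + s)
      fun k => h.mul_le_of_le hs hw (hmono k)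
  obtain ⟨k, hk⟩ := (htop.eventually_gt_atTop 1).exists
  exact hk.not_ge (h.mem_unitInterval _).2

theorem isRiccati (h : IsHittingTransform w s U) (hs : 0 < s) (hw : ∀ n, w n ∈ Set.Ioo 0 1) :
    IsRiccati (fun n => Real.log ((1 - w n) / w n)) s fun n => U n / U (n + 1) - 1 where
  nonneg n := sub_nonneg.2 <|
    (one_le_div (h.pos hs hw _)).2 (h.antitone hs hw n.le_succ)
  eq n := by
    have h1 := h.pos hs hw (n + 1)
    have h2 := h.pos hs hw (n + 2)
    have hw0 := (hw n).1
    rw [Real.exp_log (div_pos (by linarith [(hw n).2]) hw0)]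
    simp only [show n + 1 + 1 = n + 2 from rfl, add_sub_cancel]
    field_simp
    linear_combination -h.eq n

end IsHittingTransform

/-! ### The Markov property -/

theorem quenchedLaw_path (ω : Env) (x : ℤ) (p : ℕ → ℤ) (n : ℕ) :
    quenchedLaw ω x {S | ∀ i ≤ n, S i = p i} =
      (if x = p 0 then 1 else 0) * ∏ i ∈ Finset.range n, stepLaw ω (p i) {p (i + 1)} := by
  induction n with
  | zero => simp [quenchedLaw_start]
  | succ n ih => rw [quenchedLaw_step, ih, Finset.prod_range_succ, mul_assoc]

theorem ext_of_path {E : Type*} [Countable E] [MeasurableSpace E] [MeasurableSingletonClass E]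
    {μ ν : Measure (ℕ → E)} [IsFiniteMeasure μ]
    (h : ∀ (p : ℕ → E) (n : ℕ), μ {S | ∀ i ≤ n, S i = p i} = ν {S | ∀ i ≤ n, S i = p i}) :
    μ = ν := by
  let ρ (I : Finset ℕ) : Measure (I → E) := μ.map I.restrict
  have hfam : IsProjectiveMeasureFamily (α := fun _ => E) ρ :=
    isProjectiveMeasureFamily_map_restrict (X := fun n (S : ℕ → E) => S n)
      fun n => (measurable_pi_apply n).aemeasurable
  have hμ : IsProjectiveLimit μ ρ := fun _ => rfl
  refine hμ.unique ((isProjectiveLimit_nat_iff hfam ν).2 fun n => Measure.ext_of_singleton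
    fun q => ?_)
  obtain ⟨p, rfl⟩ : ∃ p, Preorder.frestrictLe (π := fun _ => E) n p = q :=
    ⟨fun j => q ⟨min j n, by simp⟩, by
      ext i
      simp [min_eq_left (Finset.mem_Iic.1 i.2)]⟩
  have e : Preorder.frestrictLe (π := fun _ => E) n ⁻¹' {Preorder.frestrictLe n p} =
      {S | ∀ i ≤ n, S i = p i} := by
    ext S
    simp [funext_iff]
  have hm := measurableSet_singleton (Preorder.frestrictLe (π := fun _ => E) n p)
  change ν.map _ _ = μ.map (Preorder.frestrictLe (π := fun _ => E) n) _
  rw [Measure.map_apply (by fun_prop) hm, Measure.map_apply (by fun_prop) hm, e, h]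

theorem quenchedLaw_ae_start (ω : Env) (x : ℤ) : ∀ᵐ S ∂(quenchedLaw ω x), S 0 = x := by
  have hm : MeasurableSet {S : ℕ → ℤ | S 0 = x} :=
    measurableSet_eq_fun (by fun_prop) (by fun_prop)
  exact (mem_ae_iff_prob_eq_one hm).2 (by rw [quenchedLaw_start, if_pos rfl])

/-- The path after one step. -/
def shift (S : ℕ → ℤ) (n : ℕ) : ℤ := S (n + 1)

theorem measurable_shift : Measurable shift :=
  measurable_pi_lambda _ fun n => measurable_pi_apply (n + 1)

theorem map_shift_quenchedLaw (ω : Env) (x : ℤ) :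
    (quenchedLaw ω x).map shift = ENNReal.ofReal (ω x : ℝ) • quenchedLaw ω (x + 1) +
      ENNReal.ofReal (1 - (ω x : ℝ)) • quenchedLaw ω (x - 1) := by
  have := Measure.isFiniteMeasure_map (quenchedLaw ω x) shift
  refine ext_of_path fun p n => ?_
  rw [Measure.map_apply measurable_shift (by measurability)]
  let p' : ℕ → ℤ := fun k => Nat.casesOn k x p
  have hpath : quenchedLaw ω x (shift ⁻¹' {S | ∀ i ≤ n, S i = p i}) =
      quenchedLaw ω x {S | ∀ i ≤ n + 1, S i = p' i} := by
    refine measure_congr ?_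
    filter_upwards [quenchedLaw_ae_start ω x] with S hS
    refine propext ⟨fun h i hi => ?_, fun h i hi => h (i + 1) (by omega)⟩
    cases i with
    | zero => exact hS
    | succ i => exact h i (by omega)
  have hstep : stepLaw ω (p' 0) {p' (0 + 1)} = ENNReal.ofReal (ω x : ℝ) *
      (if x + 1 = p 0 then 1 else 0) +
        ENNReal.ofReal (1 - (ω x : ℝ)) * (if x - 1 = p 0 then 1 else 0) := by
    simp [stepLaw, p', Set.indicator]
  rw [hpath, quenchedLaw_path, Finset.prod_range_succ', if_pos (show x = p' 0 from rfl), one_mul,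
    hstep]
  simp only [Measure.add_apply, Measure.smul_apply, smul_eq_mul, quenchedLaw_path, p']
  ring

/-- The first time `n ≥ 0` at which a path visits `a`, which is `∞` if there is none. -/
def entryTime (a : ℤ) (S : ℕ → ℤ) : ℕ∞ := ⨅ (n : ℕ) (_ : S n = a), (n : ℕ∞)

theorem hittingTime_eq_one_add_entryTime (a : ℤ) (S : ℕ → ℤ) :
    hittingTime a S = 1 + entryTime a (shift S) := by
  simp only [hittingTime, entryTime, shift, iInf_and, ENat.add_iInf]
  refine (iInf_nat_gt_zero_eq fun n => ⨅ (_ : S n = a), (n : ℕ∞)).trans ?_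
  simp only [Nat.cast_add, Nat.cast_one, add_comm]

theorem entryTime_eq_zero {a : ℤ} {S : ℕ → ℤ} (h : S 0 = a) : entryTime a S = 0 :=
  le_antisymm (iInf₂_le 0 h) zero_le

theorem entryTime_eq_hittingTime {a : ℤ} {S : ℕ → ℤ} (h : S 0 ≠ a) :
    entryTime a S = hittingTime a S := by
  refine iInf_congr fun n =>
    iInf_congr_Prop ⟨fun hn => ⟨Nat.pos_of_ne_zero ?_, hn⟩, And.right⟩ fun _ => rfl
  rintro rfl
  exact h hn

theorem measurable_entryTime (a : ℤ) : Measurable (entryTime a) := by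
  classical
  have : BorelSpace ℕ∞ := ⟨borel_eq_top_of_countable.symm⟩
  refine Measurable.iInf fun n => ?_
  simp only [iInf_eq_if]
  exact Measurable.ite (measurableSet_eq_fun (by fun_prop) (by fun_prop))
    measurable_const measurable_const

theorem measurable_hittingTime (a : ℤ) : Measurable (hittingTime a) := by
  have h : hittingTime a = (1 + ·) ∘ entryTime a ∘ shift :=
    funext (hittingTime_eq_one_add_entryTime a)
  rw [h]
  exact (measurable_of_countable _).comp ((measurable_entryTime a).comp measurable_shift)

/-! ### Laplace transforms of hitting times -/

theorem measurable_powExp (α r : ℝ) : Measurable (powExp α r) := measurable_of_countable _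

theorem powExp_nonneg (α r : ℝ) (t : ℕ∞) : 0 ≤ powExp α r t := by
  unfold powExp
  split_ifs <;> positivity

theorem powExp_zero_one_add (r : ℝ) (t : ℕ∞) :
    powExp 0 r (1 + t) = Real.exp (-r) * powExp 0 r t := by
  cases t with
  | top => simp [powExp]
  | coe n =>
    have : (1 + (n : ℕ∞)) = ((1 + n : ℕ) : ℕ∞) := by push_cast; rfl
    rw [this]
    simp only [powExp, ENat.natCast_ne_top, if_false, ENat.toNat_natCast, Real.rpow_zero, one_mul,
      ← Real.exp_add]
    push_cast
    ring_nf

/-- The maximum of `x ^ α * exp (-r * x)` over `x ≥ 0` is attained at `x = α / r`; the constant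
here drops the factor `exp (-α)`. -/
theorem powExp_le {α r : ℝ} (hα : 0 ≤ α) (hr : 0 < r) (t : ℕ∞) : powExp α r t ≤ (α / r) ^ α := by
  unfold powExp
  split_ifs
  · positivity
  set x : ℝ := (t.toNat : ℝ)
  have hx : 0 ≤ x := Nat.cast_nonneg _
  rcases hα.eq_or_lt with rfl | hα
  · simpa using mul_nonneg hr.le hx
  have h1 : x ≤ α / r * Real.exp (r * x / α) :=
    calc x = α / r * (r * x / α) := by field_simp
      _ ≤ _ := by gcongr; linarith [Real.add_one_le_exp (r * x / α)]
  calc x ^ α * Real.exp (-r * x) ≤ (α / r * Real.exp (r * x / α)) ^ α * Real.exp (-r * x) := by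
        gcongr
    _ = (α / r) ^ α * (Real.exp (r * x) * Real.exp (-r * x)) := by
        rw [Real.mul_rpow (by positivity) (Real.exp_pos _).le, ← Real.exp_mul,
          div_mul_cancel₀ _ hα.ne', mul_assoc]
    _ = (α / r) ^ α := by rw [← Real.exp_add]; simp

theorem powExp_zero_sub_le {α r R θ : ℝ} (hα : 0 ≤ α) (hr : 0 ≤ r) (hR : 0 ≤ R) (hθ : 0 < θ)
    (t : ℕ∞) : powExp 0 r t - powExp 0 R t ≤ θ + (R / θ) ^ α * powExp α r t := by
  unfold powExp
  split_ifs
  · simpa using hθ.le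
  set x : ℝ := (t.toNat : ℝ)
  have hx : 0 ≤ x := Nat.cast_nonneg _
  simp only [Real.rpow_zero, one_mul]
  rcases le_total (R * x) θ with h | h
  · have h1 : Real.exp (-r * x) ≤ 1 := Real.exp_le_one_iff.2 (by nlinarith)
    have h2 := Real.add_one_le_exp (-R * x)
    have h3 : 0 ≤ (R / θ) ^ α * (x ^ α * Real.exp (-r * x)) := by positivity
    linarith
  · have h1 : 1 ≤ (R / θ) ^ α * x ^ α := by
      rw [← Real.mul_rpow (by positivity) hx]
      refine Real.one_le_rpow ?_ hα
      rwa [div_mul_eq_mul_div, one_le_div hθ]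
    have h2 := mul_le_mul_of_nonneg_right h1 (Real.exp_pos (-r * x)).le
    have h3 := Real.exp_pos (-R * x)
    linarith

section Integral

variable {Ω : Type*} {mΩ : MeasurableSpace Ω} {μ : Measure Ω} {T : Ω → ℕ∞} {α r R c : ℝ}

theorem integrable_powExp [IsFiniteMeasure μ] (hT : Measurable T) (hα : 0 ≤ α) (hr : 0 < r) :
    Integrable (fun x => powExp α r (T x)) μ :=
  Integrable.of_bound ((measurable_powExp α r).comp hT).aestronglyMeasurable
    ((α / r) ^ α) <| ae_of_all _ fun x => by
      rw [Real.norm_of_nonneg (powExp_nonneg _ _ _)]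
      exact powExp_le hα hr _

theorem integral_powExp_le [IsProbabilityMeasure μ] (hT : Measurable T) (hα : 0 ≤ α)
    (hr : 0 < r) : ∫ x, powExp α r (T x) ∂μ ≤ (α / r) ^ α := by
  simpa using integral_mono (integrable_powExp hT hα hr) (integrable_const (μ := μ) _)
    fun x => powExp_le hα hr (T x)

/-- A gap between the Laplace transforms of `T` at `r` and at `R` forces `T` to be of order at
least `1 / R`, and not much larger than `1 / r`, with positive probability. -/
theorem le_integral_powExp_of_gap [IsProbabilityMeasure μ] (hT : Measurable T) (hα : 0 ≤ α)
    (hr : 0 < r) (hR : 0 < R) (hc : 0 < c)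
    (h : c ≤ ∫ x, powExp 0 r (T x) ∂μ - ∫ x, powExp 0 R (T x) ∂μ) :
    (c / 2 / R) ^ α * (c / 2) ≤ ∫ x, powExp α r (T x) ∂μ := by
  have hint (β) (hβ : 0 ≤ β) {s : ℝ} (hs : 0 < s) : Integrable (fun x => powExp β s (T x)) μ :=
    integrable_powExp hT hβ hs
  have h1 : c ≤ c / 2 + (R / (c / 2)) ^ α * ∫ x, powExp α r (T x) ∂μ :=
    calc c ≤ ∫ x, (powExp 0 r (T x) - powExp 0 R (T x)) ∂μ := by
          rwa [integral_sub (hint 0 le_rfl hr) (hint 0 le_rfl hR)]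
      _ ≤ ∫ x, (c / 2 + (R / (c / 2)) ^ α * powExp α r (T x)) ∂μ :=
          integral_mono ((hint 0 le_rfl hr).sub (hint 0 le_rfl hR))
            ((integrable_const _).add ((hint α hα hr).const_mul _))
            fun x => powExp_zero_sub_le hα hr.le hR.le (half_pos hc) (T x)
      _ = _ := by
          rw [integral_add (integrable_const _) ((hint α hα hr).const_mul _), integral_const_mul]
          simp
  rw [← inv_div, Real.inv_rpow (by positivity), inv_mul_le_iff₀ (by positivity)]
  linarith

end Integral

/-- The Laplace transform of the entry time into `a` of the walk started at `x`. -/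
def laplace (ω : Env) (r : ℝ) (a x : ℤ) : ℝ := ∫ S, powExp 0 r (entryTime a S) ∂(quenchedLaw ω x)

theorem laplace_mem_unitInterval (ω : Env) {r : ℝ} (hr : 0 < r) (a x : ℤ) :
    laplace ω r a x ∈ Set.Icc 0 1 :=
  ⟨integral_nonneg fun _ => powExp_nonneg _ _ _,
    (integral_powExp_le (measurable_entryTime a) le_rfl hr).trans_eq (Real.rpow_zero _)⟩

theorem laplace_self (ω : Env) (r : ℝ) (a : ℤ) : laplace ω r a a = 1 := by
  have h : (fun S => powExp 0 r (entryTime a S)) =ᵐ[quenchedLaw ω a] fun _ => 1 := by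
    filter_upwards [quenchedLaw_ae_start ω a] with S hS
    simp [entryTime_eq_zero hS, powExp]
  simp [laplace, integral_congr_ae h]

theorem laplace_eq_integral_hittingTime (ω : Env) (r : ℝ) {a x : ℤ} (hx : x ≠ a) :
    laplace ω r a x = ∫ S, powExp 0 r (hittingTime a S) ∂(quenchedLaw ω x) := by
  refine integral_congr_ae ?_
  filter_upwards [quenchedLaw_ae_start ω x] with S hS
  rw [entryTime_eq_hittingTime (by rwa [hS])]

theorem laplace_step (ω : Env) {r : ℝ} (hr : 0 < r) {a x : ℤ} (hx : x ≠ a) :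
    Real.exp r * laplace ω r a x =
      (ω x : ℝ) * laplace ω r a (x + 1) + (1 - (ω x : ℝ)) * laplace ω r a (x - 1) := by
  have hint (y : ℤ) : Integrable (fun S => powExp 0 r (entryTime a S)) (quenchedLaw ω y) :=
    integrable_powExp (measurable_entryTime a) le_rfl hr
  have hshift : laplace ω r a x =
      Real.exp (-r) * ∫ S, powExp 0 r (entryTime a S) ∂((quenchedLaw ω x).map shift) := by
    rw [laplace_eq_integral_hittingTime ω r hx,
      integral_map (f := fun S => powExp 0 r (entryTime a S)) measurable_shift.aemeasurable
      ((measurable_powExp 0 r).comp (measurable_entryTime a)).aestronglyMeasurable]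
    simp only [hittingTime_eq_one_add_entryTime, powExp_zero_one_add, integral_const_mul]
  rw [hshift, ← mul_assoc, ← Real.exp_add, add_neg_cancel, Real.exp_zero, one_mul,
    map_shift_quenchedLaw, integral_add_measure
      ((hint _).smul_measure ENNReal.ofReal_ne_top) ((hint _).smul_measure ENNReal.ofReal_ne_top),
    integral_smul_measure, integral_smul_measure, ENNReal.toReal_ofReal (ω x).2.1,
    ENNReal.toReal_ofReal (sub_nonneg.2 (ω x).2.2)]
  rfl

theorem isHittingTransform_laplace (ω : Env) {r : ℝ} (hr : 0 < r) (a : ℤ) :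
    IsHittingTransform (fun n => ω (a - (n + 1))) (Real.exp r - 1)
      fun n => laplace ω r a (a - n) where
  mem_unitInterval _ := laplace_mem_unitInterval ω hr a _
  zero := by simpa using laplace_self ω r a
  eq n := by
    have h := laplace_step ω hr (show a - (n + 1) ≠ a by omega)
    rw [show a - (n + 1 : ℤ) + 1 = a - n by ring,
      show a - (n + 1 : ℤ) - 1 = a - (n + 2) by ring] at h
    push_cast
    rwa [add_sub_cancel]

theorem exists_isRiccati (ω : Env) {r : ℝ} (hr : 0 < r)
    (hω : ∀ n : ℕ, (ω (-n) : ℝ) ∈ Set.Ioo 0 1) :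
    ∃ X, IsRiccati (fun n => logRho (-n) ω) (Real.exp r - 1) X ∧
      ∫ S, powExp 0 r (hittingTime 1 S) ∂(quenchedLaw ω 0) = 1 / (1 + X 0) := by
  have hU : IsHittingTransform (fun n => ω (-n)) (Real.exp r - 1)
      fun n => laplace ω r 1 (1 - n) := by
    simpa using isHittingTransform_laplace ω hr 1
  refine ⟨_, hU.isRiccati (by linarith [Real.add_one_lt_exp hr.ne']) hω, ?_⟩
  rw [← laplace_eq_integral_hittingTime ω r zero_ne_one]
  simp [laplace_self]

/-! ### The effect of a valley on the Laplace transform -/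

/-- The number of blocks of height at least `a` needed for a valley of depth `log (1 / R)`. -/
def valleySize (a R : ℝ) : ℕ := ⌈-Real.log R / a⌉₊

section ValleySize

variable {a R : ℝ}

theorem exp_neg_pow_valleySize_le (ha : 0 < a) (hR : 0 < R) :
    Real.exp (-a) ^ valleySize a R ≤ R := by
  have h := (div_le_iff₀ ha).1 (Nat.le_ceil (-Real.log R / a))
  rw [← Real.exp_nat_mul, ← Real.le_log_iff_exp_le hR, valleySize]
  linarith

theorem mul_exp_neg_le_exp_neg_pow_valleySize (ha : 0 < a) (hR : 0 < R) (hR1 : R ≤ 1) :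
    R * Real.exp (-a) ≤ Real.exp (-a) ^ valleySize a R := by
  have h := Nat.ceil_lt_add_one (div_nonneg (neg_nonneg.2 (Real.log_nonpos hR.le hR1)) ha.le)
  rw [div_add_one ha.ne', lt_div_iff₀ ha] at h
  rw [← Real.exp_nat_mul, ← Real.exp_log hR, ← Real.exp_add, Real.exp_le_exp, Real.exp_log hR,
    valleySize]
  linarith

theorem exp_mul_pow_valleySize_le {κ : ℝ} (hκ : 0 ≤ κ) (ha : 0 < a) (hR : 0 < R) (hR1 : R ≤ 1) :
    Real.exp (κ * a) ^ valleySize a R ≤ Real.exp (κ * a) * R ^ (-κ) :=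
  calc Real.exp (κ * a) ^ valleySize a R = (Real.exp (-a) ^ valleySize a R) ^ (-κ) := by
        rw [← Real.exp_nat_mul, ← Real.exp_nat_mul, ← Real.exp_mul]
        ring_nf
    _ ≤ (R * Real.exp (-a)) ^ (-κ) :=
        Real.rpow_le_rpow_of_nonpos (by positivity)
          (mul_exp_neg_le_exp_neg_pow_valleySize ha hR hR1) (neg_nonpos.2 hκ)
    _ = Real.exp (κ * a) * R ^ (-κ) := by
        rw [Real.mul_rpow hR.le (Real.exp_pos _).le, ← Real.exp_mul]
        ring_nf

theorem mul_rpow_le_rpow_pow_valleySize {δ : ℝ} (hδ : 0 ≤ δ) (ha : 0 < a) (hR : 0 < R)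
    (hR1 : R ≤ 1) : Real.exp (-a) ^ δ * R ^ δ ≤ (Real.exp (-a) ^ δ) ^ valleySize a R :=
  calc Real.exp (-a) ^ δ * R ^ δ = (R * Real.exp (-a)) ^ δ := by
        rw [Real.mul_rpow hR.le (Real.exp_pos _).le, mul_comm]
    _ ≤ (Real.exp (-a) ^ valleySize a R) ^ δ := by
        gcongr
        exact mul_exp_neg_le_exp_neg_pow_valleySize ha hR hR1
    _ = (Real.exp (-a) ^ δ) ^ valleySize a R := (Real.rpow_pow_comm (Real.exp_pos _).le _ _).symm

end ValleySize

theorem pos_of_two_mul_exp_neg_le_one {a : ℝ} (ha : 2 * Real.exp (-a) ≤ 1) : 0 < a := by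
  by_contra! h
  linarith [Real.one_le_exp (neg_nonneg.2 h)]

theorem two_le_exp_mul {a κ : ℝ} (ha : 2 * Real.exp (-a) ≤ 1) (hκ : 1 ≤ κ) :
    2 ≤ Real.exp (κ * a) :=
  calc (2 : ℝ) ≤ Real.exp a := by
        rwa [Real.exp_neg, mul_inv_le_iff₀ (Real.exp_pos a), one_mul] at ha
    _ ≤ Real.exp (κ * a) :=
        Real.exp_le_exp.2 (le_mul_of_one_le_left (pos_of_two_mul_exp_neg_le_one ha).le hκ)

theorem exp_sub_one_le_two_mul {r : ℝ} (hr0 : 0 ≤ r) (hr1 : r ≤ 1) :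
    Real.exp r - 1 ≤ 2 * r := by
  have h := Real.abs_exp_sub_one_le ((abs_of_nonneg hr0).trans_le hr1)
  rw [abs_of_nonneg hr0] at h
  exact (le_abs_self _).trans h

theorem tendsto_rpow_nhdsGT_zero {y : ℝ} (hy : 0 < y) :
    Tendsto (fun r : ℝ => r ^ y) (𝓝[>] 0) (𝓝 0) := by
  have h := (Real.continuousAt_rpow_const 0 y (Or.inr hy.le)).tendsto
  rw [Real.zero_rpow hy.ne'] at h
  exact h.mono_left nhdsWithin_le_nhds

theorem eventually_nhdsGT_zero_mem_Ioo : ∀ᶠ r in 𝓝[>] (0 : ℝ), r ∈ Set.Ioo 0 1 :=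
  Ioo_mem_nhdsGT one_pos

/-- A valley of depth `log (1 / R)` is too shallow to delay a walk killed at rate `r`, as soon as
`r` is small compared to `R ^ (1 + δ)`. -/
theorem eventually_le_of_isValley {a δ L b : ℝ} {M : ℕ} (hδ : δ ∈ Set.Ioo 0 1)
    (ha : 2 * Real.exp (-a) ≤ 1) (hb : 0 < b) :
    ∀ᶠ r in 𝓝[>] (0 : ℝ), ∀ z X : ℕ → ℝ, IsRiccati z (Real.exp r - 1) X → (∀ n, z n ≤ L) →
      IsValley z a ((1 + δ) * a) M (valleySize a (r ^ (1 - δ))) → X 0 ≤ b := by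
  obtain ⟨hδ0, hδ1⟩ := hδ
  have ha0 := pos_of_two_mul_exp_neg_le_one ha
  set C := 3 * ((1 + Real.exp L) * ∑ i ∈ Finset.range M, Real.exp L ^ i) with hC
  set C' := 2 * (1 + Real.exp L) + Real.exp L with hC'
  have hlim : Tendsto (fun r : ℝ => Real.exp ((1 + δ) * a) *
      (2 * C * r ^ (δ ^ 2) + C' * r ^ ((1 - δ) * (2 - δ)))) (𝓝[>] 0) (𝓝 0) := by
    have h1 := tendsto_rpow_nhdsGT_zero (pow_pos hδ0 2)
    have h2 := tendsto_rpow_nhdsGT_zero (mul_pos (sub_pos.2 hδ1) (by linarith : 0 < 2 - δ))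
    simpa using ((h1.const_mul (2 * C)).add (h2.const_mul C')).const_mul (Real.exp ((1 + δ) * a))
  filter_upwards [hlim.eventually_le_const hb, eventually_nhdsGT_zero_mem_Ioo]
    with r hr ⟨hr0, hr1⟩ z X hX hz hV
  refine le_trans ?_ hr
  set R := r ^ (1 - δ) with hR
  have hR0 : 0 < R := Real.rpow_pos_of_pos hr0 _
  have hR1 : R ≤ 1 := Real.rpow_le_one hr0.le hr1.le (by linarith)
  have hs0 : 0 ≤ Real.exp r - 1 := by linarith [Real.add_one_le_exp r]
  have hs : Real.exp r - 1 ≤ 2 * r := exp_sub_one_le_two_mul hr0.le hr1.le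
  have hA : 2 ≤ Real.exp ((1 + δ) * a) := two_le_exp_mul ha (by linarith)
  have hC'_le : (Real.exp r - 1) * (1 + Real.exp L) + Real.exp L ≤ C' := by
    rw [hC']
    gcongr
    linarith
  have hfar : Real.exp (-a) ^ (3 * valleySize a R) ≤ R ^ (3 : ℝ) := by
    rw [mul_comm, pow_mul]
    exact_mod_cast pow_le_pow_left₀ (by positivity) (exp_neg_pow_valleySize_le ha0 hR0) 3
  calc X 0 ≤ Real.exp ((1 + δ) * a) ^ valleySize a R * ((Real.exp r - 1) * C +
        Real.exp (-a) ^ (3 * valleySize a R) *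
          ((Real.exp r - 1) * (1 + Real.exp L) + Real.exp L)) := by
        refine (hX.le_of_isValley hz hs0 hV ha hA).trans_eq ?_
        rw [hC]
        ring
    _ ≤ Real.exp ((1 + δ) * a) * R ^ (-(1 + δ)) * (2 * r * C + R ^ (3 : ℝ) * C') := by
        gcongr
        exact exp_mul_pow_valleySize_le (by linarith) ha0 hR0 hR1
    _ = Real.exp ((1 + δ) * a) * (2 * C * (R ^ (-(1 + δ)) * r) +
          C' * (R ^ (-(1 + δ)) * R ^ (3 : ℝ))) := by ring
    _ = _ := by
        rw [← Real.rpow_add hR0, hR, ← Real.rpow_mul hr0.le, ← Real.rpow_mul hr0.le,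
          ← Real.rpow_add_one hr0.ne']
        ring_nf

theorem abs_logRho_le {ω : Env} {i : ℤ} {ε : ℝ} (hε : 0 < ε)
    (hω : (ω i : ℝ) ∈ Set.Icc ε (1 - ε)) : |logRho i ω| ≤ -Real.log ε := by
  obtain ⟨h1, h2⟩ := hω
  have hω0 : 0 < (ω i : ℝ) := by linarith
  have hω1 : 0 < 1 - (ω i : ℝ) := by linarith
  have hlog0 := Real.log_nonpos hω0.le (by linarith)
  have hlog1 := Real.log_nonpos hω1.le (by linarith)
  have := Real.log_le_log hε h1
  have := Real.log_le_log hε (by linarith : ε ≤ 1 - ω i)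
  rw [logRho, Real.log_div hω1.ne' hω0.ne', abs_le]
  constructor <;> linarith

/-- In an environment with a valley of depth `log (1 / R)`, `R = r ^ (1 - δ)`, the walk reaches `1`
before an exponential time of rate `r` with probability close to `1`, but it fails to do so before
an exponential time of rate `R` with probability bounded below. -/
theorem exists_laplace_gap {ε δ a : ℝ} {M : ℕ} (hε : 0 < ε) (hδ : δ ∈ Set.Ioo 0 1)
    (ha : 2 * Real.exp (-a) ≤ 1) :
    ∃ c > 0, ∀ᶠ r in 𝓝[>] (0 : ℝ), ∀ ω : Env,
      (∀ n : ℕ, (ω (-n) : ℝ) ∈ Set.Icc ε (1 - ε)) →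
      IsValley (fun n => logRho (-n) ω) a ((1 + δ) * a) M (valleySize a (r ^ (1 - δ))) →
      c ≤ ∫ S, powExp 0 r (hittingTime 1 S) ∂(quenchedLaw ω 0) -
        ∫ S, powExp 0 (r ^ (1 - δ)) (hittingTime 1 S) ∂(quenchedLaw ω 0) := by
  have ha0 := pos_of_two_mul_exp_neg_le_one ha
  set L := -Real.log ε
  set b := (2 * (Real.exp L * ∑ i ∈ Finset.range M, Real.exp L ^ i) + 1)⁻¹
  have hb : 0 < b := by positivity
  refine ⟨1 / (1 + b / 2) - 1 / (1 + b),
    sub_pos.2 (one_div_lt_one_div_of_lt (by positivity) (by linarith)), ?_⟩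
  filter_upwards [eventually_le_of_isValley (L := L) (M := M) hδ ha (half_pos hb),
    self_mem_nhdsWithin] with r hr (hr0 : 0 < r) ω hω hV
  set R := r ^ (1 - δ)
  have hR : 0 < R := Real.rpow_pos_of_pos hr0 _
  have hω' (n : ℕ) : (ω (-n) : ℝ) ∈ Set.Ioo 0 1 :=
    ⟨by linarith [(hω n).1], by linarith [(hω n).2]⟩
  have hz (n : ℕ) := abs_le.1 (abs_logRho_le hε (hω n))
  obtain ⟨X, hX, hX_eq⟩ := exists_isRiccati ω hr0 hω'
  obtain ⟨Y, hY, hY_eq⟩ := exists_isRiccati ω hR hω'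
  have hXb : X 0 ≤ b / 2 := hr _ X hX (fun n => (hz n).2) hV
  have hYb : b ≤ Y 0 := by
    have hs : R ≤ Real.exp R - 1 := by linarith [Real.add_one_le_exp R]
    have hinv := hY.inv_le_of_isValley (fun n => neg_le.1 (hz n).1) (hR.trans_le hs) hV ha
      ((exp_neg_pow_valleySize_le ha0 hR).trans hs)
    exact inv_le_of_inv_le₀ ((hR.trans_le hs).trans_le (hY.le_self (hR.le.trans hs) 0)) hinv
  have := hX.nonneg 0
  rw [hX_eq, hY_eq]
  gcongr

/-! ### The probability of a valley -/

theorem iIndepFun_curry {Ω ι κ E : Type*} {mΩ : MeasurableSpace Ω} {mE : MeasurableSpace E}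
    {P : Measure Ω} {X : ι → κ → Ω → E} (hX : ∀ i j, Measurable (X i j))
    (h : iIndepFun (fun p : ι × κ => X p.1 p.2) P) : iIndepFun (fun i ω j => X i j ω) P := by
  have := h.isProbabilityMeasure
  have (i : ι) (j : κ) : IsProbabilityMeasure (P.map (X i j)) :=
    Measure.isProbabilityMeasure_map (hX i j).aemeasurable
  have hrow (i : ι) : iIndepFun (X i) P :=
    h.precomp (g := fun j => (i, j)) (Prod.mk_right_injective i)
  rw [iIndepFun_iff_map_fun_eq_infinitePi_map (by fun_prop)]
  calc P.map (fun ω i j => X i j ω)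
      = (P.map fun ω (p : ι × κ) => X p.1 p.2 ω).map (MeasurableEquiv.curry ι κ E) := by
        rw [Measure.map_map (by fun_prop) (by fun_prop)]
        rfl
    _ = Measure.infinitePi fun i => Measure.infinitePi fun j => P.map (X i j) := by
        rw [(iIndepFun_iff_map_fun_eq_infinitePi_map (by fun_prop)).1 h]
        exact Measure.infinitePi_map_curry fun i j => P.map (X i j)
    _ = Measure.infinitePi fun i => P.map fun ω j => X i j ω := by
        congr 1 with i : 1
        exact ((iIndepFun_iff_map_fun_eq_infinitePi_map (hX i)).1 (hrow i)).symm

section Valley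

variable {Ω : Type*} {mΩ : MeasurableSpace Ω} {P : Measure Ω} {X : ℕ → Ω → ℝ}

theorem pow_le_measureReal_forall_mem {E : Type*} {mE : MeasurableSpace E} {Y : ℕ → Ω → E}
    (hY : iIndepFun Y P) {I : ℕ → Set E} (hI : ∀ j, MeasurableSet (I j)) {p : ℝ} (hp0 : 0 ≤ p)
    (hp : ∀ j, p ≤ P.real {ω | Y j ω ∈ I j}) (n : ℕ) :
    p ^ n ≤ P.real {ω | ∀ j < n, Y j ω ∈ I j} := by
  have hset : {ω | ∀ j < n, Y j ω ∈ I j} = ⋂ j ∈ Finset.range n, Y j ⁻¹' I j := by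
    ext ω
    simp
  rw [hset, measureReal_def, hY.measure_inter_preimage_eq_mul _ fun j _ => hI j,
    ENNReal.toReal_prod]
  calc p ^ n = ∏ _j ∈ Finset.range n, p := by simp
    _ ≤ ∏ j ∈ Finset.range n, (P (Y j ⁻¹' I j)).toReal :=
        Finset.prod_le_prod (fun _ _ => hp0) fun j _ => hp j

theorem iIndepFun_blockSum (hX : ∀ i, Measurable (X i)) (hindep : iIndepFun X P) (M : ℕ) :
    iIndepFun (fun j ω => blockSum (X · ω) M j) P := by
  have hinj : Function.Injective fun p : ℕ × Fin M => p.1 * M + p.2 := by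
    rintro ⟨j, i⟩ ⟨j', i'⟩ h
    have hM : 0 < M := i.pos
    have hi := congrArg (· % M) h
    have hj := congrArg (· / M) h
    simp only [Nat.mul_add_mod_self_right, Nat.mod_eq_of_lt i.2, Nat.mod_eq_of_lt i'.2] at hi
    simp only [Nat.mul_comm _ M, Nat.mul_add_div hM, Nat.div_eq_of_lt i.2,
      Nat.div_eq_of_lt i'.2] at hj
    exact Prod.ext (by simpa using hj) (Fin.ext hi)
  have h := (iIndepFun_curry (X := fun j (i : Fin M) => X (j * M + i)) (fun _ _ => hX _)
    (hindep.precomp hinj)).comp (fun _ x => ∑ i, x i) fun _ => by fun_prop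
  simp only [blockSum, Finset.sum_range]
  exact h

theorem identDistrib_blockSum (hindep : iIndepFun X P)
    (hident : ∀ i, IdentDistrib (X i) (X 0) P P) (M j : ℕ) :
    IdentDistrib (fun ω => blockSum (X · ω) M j) (fun ω => ∑ i ∈ Finset.range M, X i ω) P P :=
  (IdentDistrib.pi (X := fun i => X (j * M + i)) (Y := X)
    (fun i => (hident _).trans (hident i).symm)
    (hindep.precomp (g := fun i => j * M + i) (add_right_injective _)) hindep).comp
    (u := fun x : ℕ → ℝ => ∑ i ∈ Finset.range M, x i) (by fun_prop)

theorem exists_eventually_le_measureReal_sum_mem [IsProbabilityMeasure P] (hm : MemLp (X 0) 2 P)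
    (h0 : P[X 0] = 0) (hv : 0 < Var[X 0; P]) (hindep : iIndepFun X P)
    (hident : ∀ i, IdentDistrib (X i) (X 0) P P) {G : Set ℝ} (hG : IsOpen G) (hne : G.Nonempty) :
    ∃ p > 0, ∀ᶠ n : ℕ in atTop,
      p ≤ P.real {ω | (√n)⁻¹ * ∑ k ∈ Finset.range n, X k ω ∈ G} := by
  have hclt := tendstoInDistribution_inv_sqrt_mul_sum_sub (X := X) (P := P)
    (Y := id) (P' := gaussianReal 0 Var[X 0; P].toNNReal) HasLaw.id hm hindep hident
  have hpos : 0 < gaussianReal 0 Var[X 0; P].toNNReal G := pos_iff_ne_zero.2 fun h =>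
    (hG.measure_pos volume hne).ne' (gaussianReal_absolutelyContinuous' 0 (by simpa using hv) h)
  obtain ⟨p, hp0, hp⟩ := exists_between hpos
  have hlim := ProbabilityMeasure.le_liminf_measure_open_of_tendsto hclt.tendsto hG
  refine ⟨p.toReal, ENNReal.toReal_pos hp0.ne' (ne_top_of_lt hp), ?_⟩
  filter_upwards [eventually_lt_of_lt_liminf (hp.trans_le (le_of_eq_of_le (by simp) hlim))]
    with n hn
  refine ENNReal.toReal_mono (measure_ne_top _ _) (hn.le.trans_eq ?_)
  simp only [ProbabilityMeasure.coe_mk]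
  rw [Measure.map_apply_of_aemeasurable (hclt.forall_aemeasurable n) hG.measurableSet, h0]
  simp only [mul_zero, sub_zero]
  rfl

theorem pow_le_measureReal_isValley [IsFiniteMeasure P] (hX : ∀ i, Measurable (X i))
    (hindep : iIndepFun X P) (hident : ∀ i, IdentDistrib (X i) (X 0) P P) {M : ℕ} {p a A : ℝ}
    (hp0 : 0 ≤ p) (hdesc : p ≤ P.real {ω | ∑ i ∈ Finset.range M, X i ω ∈ Set.Icc a A})
    (hasc : p ≤ P.real {ω | ∑ i ∈ Finset.range M, X i ω ∈ Set.Iic (-a)}) (K : ℕ) :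
    p ^ (4 * K) ≤ P.real {ω | IsValley (X · ω) a A M K} := by
  let I (j : ℕ) : Set ℝ := if j < K then Set.Icc a A else Set.Iic (-a)
  have hI (j : ℕ) : MeasurableSet (I j) := by
    simp only [I]
    split_ifs <;> measurability
  have hprob (j : ℕ) : p ≤ P.real {ω | blockSum (X · ω) M j ∈ I j} := by
    have hlaw := (identDistrib_blockSum hindep hident M j).measure_mem_eq (hI j)
    refine le_trans ?_ (congrArg ENNReal.toReal hlaw).ge
    simp only [I]
    split_ifs
    · exact hdesc
    · exact hasc
  refine (pow_le_measureReal_forall_mem (iIndepFun_blockSum hX hindep M) hI hp0 hprob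
    (4 * K)).trans (measureReal_mono fun ω hω => ⟨fun j hj => ?_, fun j hj hj' => ?_⟩)
  · simpa only [I, if_pos hj] using hω j (by omega)
  · simpa only [I, if_neg hj.not_gt, Set.mem_Iic] using hω j hj'

theorem exists_pow_le_measureReal_isValley [IsProbabilityMeasure P] (hX : ∀ i, Measurable (X i))
    (h0 : P[X 0] = 0) (hv : 0 < Var[X 0; P]) (hindep : iIndepFun X P)
    (hident : ∀ i, IdentDistrib (X i) (X 0) P P) {κ : ℝ} (hκ : 0 < κ) :
    ∃ p > 0, ∀ᶠ M : ℕ in atTop, ∀ K : ℕ,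
      p ^ (4 * K) ≤ P.real {ω | IsValley (X · ω) √M ((1 + κ) * √M) M K} := by
  have hm : MemLp (X 0) 2 P :=
    memLp_two_of_variance_ne_zero (hX 0).aestronglyMeasurable hv.ne'
  obtain ⟨p₁, hp₁, h₁⟩ := exists_eventually_le_measureReal_sum_mem hm h0 hv hindep hident
    (isOpen_Ioo (a := (1 : ℝ)) (b := 1 + κ)) (Set.nonempty_Ioo.2 (by linarith))
  obtain ⟨p₂, hp₂, h₂⟩ := exists_eventually_le_measureReal_sum_mem hm h0 hv hindep hident
    (isOpen_Iio (a := (-1 : ℝ))) Set.nonempty_Iio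
  refine ⟨min p₁ p₂, lt_min hp₁ hp₂, ?_⟩
  filter_upwards [h₁, h₂, eventually_gt_atTop 0] with M h₁ h₂ hM
  have hsq : 0 < √(M : ℝ) := Real.sqrt_pos.2 (by exact_mod_cast hM)
  refine pow_le_measureReal_isValley hX hindep hident (lt_min hp₁ hp₂).le
    ((min_le_left _ _).trans (h₁.trans (measureReal_mono fun ω h => ?_)))
    ((min_le_right _ _).trans (h₂.trans (measureReal_mono fun ω h => ?_)))
  · simp only [Set.mem_ofPred_eq, Set.mem_Ioo, inv_mul_eq_div, lt_div_iff₀ hsq,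
      div_lt_iff₀ hsq, one_mul] at h
    exact ⟨h.1.le, h.2.le⟩
  · simp only [Set.mem_ofPred_eq, Set.mem_Iio, inv_mul_eq_div, div_lt_iff₀ hsq] at h
    exact h.le.trans_eq (neg_one_mul _)

/-- By diffusive scaling, a valley with `K` blocks of descent has depth at least `√M * K`, while
its probability is at least `p ^ (4 * K)` with `p` independent of `M`: take `M` large. -/
theorem exists_rpow_pow_le_measureReal_isValley [IsProbabilityMeasure P]
    (hX : ∀ i, Measurable (X i)) (h0 : P[X 0] = 0) (hv : 0 < Var[X 0; P]) (hindep : iIndepFun X P)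
    (hident : ∀ i, IdentDistrib (X i) (X 0) P P) {κ : ℝ} (hκ : 0 < κ) :
    ∃ (a : ℝ) (M : ℕ), 2 * Real.exp (-a) ≤ 1 ∧ ∀ K : ℕ,
      (Real.exp (-a) ^ κ) ^ K ≤ P.real {ω | IsValley (X · ω) a ((1 + κ) * a) M K} := by
  obtain ⟨p, hp0, hp⟩ := exists_pow_le_measureReal_isValley hX h0 hv hindep hident hκ
  have hexp : Tendsto (fun M : ℕ => Real.exp (-√M)) atTop (𝓝 0) :=
    Real.tendsto_exp_neg_atTop_nhds_zero.comp
      (Real.tendsto_sqrt_atTop.comp tendsto_natCast_atTop_atTop)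
  have hexp_rpow := hexp.rpow_const (p := κ) (Or.inr hκ.le)
  rw [Real.zero_rpow hκ.ne'] at hexp_rpow
  obtain ⟨M, hM, hM2, hMp⟩ := (hp.and ((hexp.eventually_le_const one_half_pos).and
    (hexp_rpow.eventually_le_const (pow_pos hp0 4)))).exists
  refine ⟨√M, M, by linarith, fun K => ?_⟩
  calc (Real.exp (-√M) ^ κ) ^ K ≤ (p ^ 4) ^ K := by gcongr
    _ = p ^ (4 * K) := (pow_mul _ _ _).symm
    _ ≤ _ := hM K

end Valley

theorem measurable_logRho (i : ℤ) : Measurable (logRho i) := by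
  unfold logRho
  fun_prop

theorem exists_rpow_pow_le_measureReal_isValley_logRho {η : Measure Env} [IsProbabilityMeasure η]
    (h_indep : iIndepFun (fun (i : ℤ) (ω : Env) => ω i) η)
    (h_ident : ∀ i : ℤ, IdentDistrib (fun ω : Env => ω i) (fun ω : Env => ω 0) η η)
    (h_rec : ∫ ω, logRho 0 ω ∂η = 0) (h_var : 0 < variance (logRho 0) η) {κ : ℝ} (hκ : 0 < κ) :
    ∃ (a : ℝ) (M : ℕ), 2 * Real.exp (-a) ≤ 1 ∧ ∀ K : ℕ, (Real.exp (-a) ^ κ) ^ K ≤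
      η.real {ω | IsValley (fun n => logRho (-n) ω) a ((1 + κ) * a) M K} := by
  have hlog : Measurable fun x : unitInterval => Real.log ((1 - (x : ℝ)) / (x : ℝ)) := by fun_prop
  refine exists_rpow_pow_le_measureReal_isValley (X := fun n => logRho (-n))
    (fun n => measurable_logRho _) (by simpa using h_rec) (by simpa using h_var) ?_ (fun n => ?_) hκ
  · exact (h_indep.comp (fun _ x => Real.log ((1 - (x : ℝ)) / (x : ℝ))) fun _ => hlog).precomp
      (g := fun n : ℕ => -(n : ℤ)) (fun a b h => by simpa using h)
  · exact ((h_ident (-(n : ℤ))).trans (h_ident (-((0 : ℕ) : ℤ))).symm).comp hlog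

/-! ### Annealed expectations -/

instance (η : Measure Env) [IsProbabilityMeasure η] : IsProbabilityMeasure (annealedLaw η) :=
  ⟨by simp [annealedLaw_apply η MeasurableSet.univ]⟩

theorem mul_measureReal_le_integral_comp {α β : Type*} {mα : MeasurableSpace α}
    {mβ : MeasurableSpace β} {μ : Measure α} [IsFiniteMeasure μ] {κ : Kernel α β} {f : β → ℝ}
    (hf : Integrable f (κ ∘ₘ μ)) (hf0 : 0 ≤ f) {c : ℝ} (hc : 0 ≤ c) {V : Set α}
    (hV : ∀ᵐ x ∂μ, x ∈ V → c ≤ ∫ y, f y ∂(κ x)) : c * μ.real V ≤ ∫ y, f y ∂(κ ∘ₘ μ) := by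
  rw [Measure.comp_eq_comp_const_apply] at hf ⊢
  calc c * μ.real V ≤ c * μ.real {x | c ≤ ∫ y, f y ∂(κ x)} :=
        mul_le_mul_of_nonneg_left
          (ENNReal.toReal_mono (measure_ne_top _ _) (measure_mono_ae hV)) hc
    _ ≤ ∫ x, ∫ y, f y ∂(κ x) ∂μ :=
        mul_meas_ge_le_integral_of_nonneg (ae_of_all _ fun x => integral_nonneg hf0)
          (by simpa using hf.integral_comp) c
    _ = _ := by
        rw [Kernel.integral_comp hf]
        simp

theorem ae_forall_mem_Icc {η : Measure Env} {ε : ℝ}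
    (h_ident : ∀ i : ℤ, IdentDistrib (fun ω : Env => ω i) (fun ω : Env => ω 0) η η)
    (h_ellip : ∀ᵐ ω ∂η, (ω 0 : ℝ) ∈ Set.Icc ε (1 - ε)) :
    ∀ᵐ ω ∂η, ∀ i : ℤ, (ω i : ℝ) ∈ Set.Icc ε (1 - ε) :=
  ae_all_iff.2 fun i =>
    (h_ident i).symm.ae_snd (measurableSet_Icc.preimage measurable_subtype_coe) h_ellip

theorem exists_eventually_le_integral_annealedLaw {η : Measure Env} [IsProbabilityMeasure η]
    (h_indep : iIndepFun (fun (i : ℤ) (ω : Env) => ω i) η)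
    (h_ident : ∀ i : ℤ, IdentDistrib (fun ω : Env => ω i) (fun ω : Env => ω 0) η η)
    (h_ellip : ∃ ε > 0, ∀ᵐ ω ∂η, (ω 0 : ℝ) ∈ Set.Icc ε (1 - ε))
    (h_rec : ∫ ω, logRho 0 ω ∂η = 0) (h_var : 0 < variance (logRho 0) η)
    {α δ : ℝ} (hα : 0 ≤ α) (hδ : δ ∈ Set.Ioo 0 1) :
    ∃ C > 0, ∀ᶠ r in 𝓝[>] (0 : ℝ), C * r ^ ((1 - δ) * (δ - α)) ≤
      ∫ S, powExp α r (hittingTime 1 S) ∂(annealedLaw η) := by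
  obtain ⟨ε, hε, h_ellip⟩ := h_ellip
  obtain ⟨a, M, ha, hprob⟩ :=
    exists_rpow_pow_le_measureReal_isValley_logRho h_indep h_ident h_rec h_var hδ.1
  obtain ⟨c, hc, hgap⟩ := exists_laplace_gap (M := M) hε hδ ha
  refine ⟨(c / 2) ^ α * (c / 2) * Real.exp (-a) ^ δ, by positivity, ?_⟩
  filter_upwards [hgap, eventually_nhdsGT_zero_mem_Ioo] with r hgap ⟨hr0, hr1⟩
  have h_int : Integrable (fun S => powExp α r (hittingTime 1 S)) (annealedLaw η) :=
    integrable_powExp (measurable_hittingTime 1) hα hr0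
  set R := r ^ (1 - δ) with hR
  have hR0 : 0 < R := Real.rpow_pos_of_pos hr0 _
  have hR1 : R ≤ 1 := Real.rpow_le_one hr0.le hr1.le (by linarith [hδ.2])
  set V : Set Env :=
    {ω | IsValley (fun n => logRho (-n) ω) a ((1 + δ) * a) M (valleySize a R)}
  have hV : ∀ᵐ ω ∂η, ω ∈ V →
      (c / 2 / R) ^ α * (c / 2) ≤ ∫ S, powExp α r (hittingTime 1 S) ∂(quenchedLaw ω 0) := by
    filter_upwards [ae_forall_mem_Icc h_ident h_ellip] with ω hω hωV
    exact le_integral_powExp_of_gap (measurable_hittingTime 1) hα hr0 hR0 hc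
      (hgap ω (fun n => hω (-n)) hωV)
  calc (c / 2) ^ α * (c / 2) * Real.exp (-a) ^ δ * r ^ ((1 - δ) * (δ - α))
      = (c / 2 / R) ^ α * (c / 2) * (Real.exp (-a) ^ δ * R ^ δ) := by
        rw [Real.rpow_mul hr0.le, ← hR, Real.rpow_sub hR0, Real.div_rpow (by positivity) hR0.le]
        ring
    _ ≤ (c / 2 / R) ^ α * (c / 2) * η.real V := by
        gcongr
        exact (mul_rpow_le_rpow_pow_valleySize hδ.1.le (pos_of_two_mul_exp_neg_le_one ha)
          hR0 hR1).trans (hprob _)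
    _ ≤ ∫ S, powExp α r (hittingTime 1 S) ∂(annealedLaw η) :=
        mul_measureReal_le_integral_comp (κ := ⟨_, measurable_quenchedLaw 0⟩) h_int
          (fun S => powExp_nonneg _ _ _) (by positivity) hV

section Exponent

variable {F : ℝ → ℝ} {C β γ : ℝ}

theorem eventually_lt_log_div_neg_log (hC : 0 < C)
    (h : ∀ᶠ r in 𝓝[>] (0 : ℝ), C * r ^ (-β) ≤ F r) (hγ : γ < β) :
    ∀ᶠ r in 𝓝[>] (0 : ℝ), γ < Real.log (F r) / -Real.log r := by
  have hlog : Tendsto (fun r : ℝ => -Real.log r) (𝓝[>] 0) atTop :=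
    tendsto_neg_atBot_atTop.comp Real.tendsto_log_nhdsGT_zero
  filter_upwards [h, self_mem_nhdsWithin, hlog.eventually_gt_atTop 0,
    hlog.eventually_gt_atTop (-Real.log C / (β - γ))] with r hF hr hr1 hrC
  have hr0 : 0 < r := hr
  have hlogF := Real.log_le_log (mul_pos hC (Real.rpow_pos_of_pos hr0 _)) hF
  rw [Real.log_mul hC.ne' (Real.rpow_pos_of_pos hr0 _).ne', Real.log_rpow hr0] at hlogF
  rw [div_lt_iff₀ (sub_pos.2 hγ)] at hrC
  rw [lt_div_iff₀ hr1]
  linarith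

theorem eventually_log_div_neg_log_lt (hC : 0 < C) (hF : ∀ᶠ r in 𝓝[>] (0 : ℝ), 0 < F r)
    (h : ∀ᶠ r in 𝓝[>] (0 : ℝ), F r ≤ C * r ^ (-β)) (hγ : β < γ) :
    ∀ᶠ r in 𝓝[>] (0 : ℝ), Real.log (F r) / -Real.log r < γ := by
  have h_inv : ∀ᶠ r in 𝓝[>] (0 : ℝ), C⁻¹ * r ^ (-(-β)) ≤ (F r)⁻¹ := by
    filter_upwards [h, hF, self_mem_nhdsWithin] with r h hF (hr : 0 < r)
    rw [Real.rpow_neg hr.le, ← mul_inv]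
    exact inv_anti₀ hF h
  filter_upwards [eventually_lt_log_div_neg_log (inv_pos.2 hC) h_inv (neg_lt_neg hγ)] with r hr
  rwa [Real.log_inv, neg_div, neg_lt_neg_iff] at hr

theorem exists_eq_one_div_rpow_add {α : ℝ} (hC : 0 < C)
    (hupper : ∀ᶠ r in 𝓝[>] (0 : ℝ), F r ≤ C * r ^ (-α))
    (hlower : ∀ β < α, ∃ c > 0, ∀ᶠ r in 𝓝[>] (0 : ℝ), c * r ^ (-β) ≤ F r) :
    ∃ o : ℝ → ℝ, Tendsto o (𝓝[>] 0) (𝓝 0) ∧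
      ∀ᶠ r in 𝓝[>] (0 : ℝ), F r = (1 / r) ^ (α + o r) := by
  have hpos : ∀ᶠ r in 𝓝[>] (0 : ℝ), 0 < F r := by
    obtain ⟨c, hc, h⟩ := hlower (α - 1) (sub_one_lt α)
    filter_upwards [h, self_mem_nhdsWithin] with r h hr
    exact (mul_pos hc (Real.rpow_pos_of_pos hr _)).trans_le h
  have hlim : Tendsto (fun r => Real.log (F r) / -Real.log r) (𝓝[>] 0) (𝓝 α) := by
    refine tendsto_order.2 ⟨fun γ hγ => ?_,
      fun γ hγ => eventually_log_div_neg_log_lt hC hpos hupper hγ⟩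
    obtain ⟨β, hγβ, hβ⟩ := exists_between hγ
    obtain ⟨c, hc, h⟩ := hlower β hβ
    exact eventually_lt_log_div_neg_log hc h hγβ
  refine ⟨fun r => Real.log (F r) / -Real.log r - α, by simpa using hlim.sub_const α, ?_⟩
  filter_upwards [hpos, eventually_nhdsGT_zero_mem_Ioo] with r hF ⟨hr0, hr1⟩
  rw [add_sub_cancel, Real.rpow_def_of_pos (one_div_pos.2 hr0), one_div, Real.log_inv,
    mul_div_cancel₀ _ (neg_ne_zero.2 (Real.log_neg hr0 hr1).ne), Real.exp_log hF]

end Exponent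

theorem exists_mem_Ioo_lt_mul_sub {α β : ℝ} (h : β < α) :
    ∃ δ ∈ Set.Ioo (0 : ℝ) 1, β < (1 - δ) * (α - δ) := by
  have hlim : Tendsto (fun δ : ℝ => (1 - δ) * (α - δ)) (𝓝[>] 0) (𝓝 α) := by
    have hcont : Continuous fun δ : ℝ => (1 - δ) * (α - δ) := by fun_prop
    exact (hcont.tendsto' 0 α (by simp)).mono_left nhdsWithin_le_nhds
  exact (eventually_nhdsGT_zero_mem_Ioo.and (hlim.eventually_const_lt h)).exists

theorem exists_eventually_rpow_neg_le_integral_annealedLaw {η : Measure Env}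
    [IsProbabilityMeasure η]
    (h_indep : iIndepFun (fun (i : ℤ) (ω : Env) => ω i) η)
    (h_ident : ∀ i : ℤ, IdentDistrib (fun ω : Env => ω i) (fun ω : Env => ω 0) η η)
    (h_ellip : ∃ ε > 0, ∀ᵐ ω ∂η, (ω 0 : ℝ) ∈ Set.Icc ε (1 - ε))
    (h_rec : ∫ ω, logRho 0 ω ∂η = 0) (h_var : 0 < variance (logRho 0) η)
    {α β : ℝ} (hα : 0 ≤ α) (hβ : β < α) :
    ∃ C > 0, ∀ᶠ r in 𝓝[>] (0 : ℝ), C * r ^ (-β) ≤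
      ∫ S, powExp α r (hittingTime 1 S) ∂(annealedLaw η) := by
  obtain ⟨δ, hδ, hβδ⟩ := exists_mem_Ioo_lt_mul_sub hβ
  obtain ⟨C, hC, h⟩ :=
    exists_eventually_le_integral_annealedLaw h_indep h_ident h_ellip h_rec h_var hα hδ
  refine ⟨C, hC, ?_⟩
  filter_upwards [h, eventually_nhdsGT_zero_mem_Ioo] with r hr ⟨hr0, hr1⟩
  refine le_trans ?_ hr
  gcongr C * ?_
  exact Real.rpow_le_rpow_of_exponent_ge hr0 hr1.le (by linarith)

end RWRE

end

theorem proposition1p2 (η : Measure RWRE.Env) [IsProbabilityMeasure η]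
    (h_indep : iIndepFun (fun (i : ℤ) (ω : RWRE.Env) => ω i) η)
    (h_ident : ∀ i : ℤ, IdentDistrib (fun ω : RWRE.Env => ω i) (fun ω : RWRE.Env => ω 0) η η)
    (h_ellip : ∃ ε₀ : ℝ, 0 < ε₀ ∧ ∀ᵐ ω ∂η, ε₀ ≤ (ω 0 : ℝ) ∧ (ω 0 : ℝ) ≤ 1 - ε₀)
    (h_rec : ∫ ω, RWRE.logRho 0 ω ∂η = 0)
    (h_var : 0 < variance (RWRE.logRho 0) η)
    (α : ℝ) (hα : 0 < α) :
    ∃ o : ℝ → ℝ, Tendsto o (𝓝[>] 0) (𝓝 0) ∧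
      ∀ᶠ r in 𝓝[>] (0 : ℝ),
        Integrable (fun S => RWRE.powExp α r (RWRE.hittingTime 1 S)) (RWRE.annealedLaw η) ∧
        ∫ S, RWRE.powExp α r (RWRE.hittingTime 1 S) ∂(RWRE.annealedLaw η) =
          (1 / r) ^ (α + o r) := by
  have hτ := RWRE.measurable_hittingTime 1
  have hupper : ∀ᶠ r in 𝓝[>] (0 : ℝ),
      ∫ S, RWRE.powExp α r (RWRE.hittingTime 1 S) ∂(RWRE.annealedLaw η) ≤ α ^ α * r ^ (-α) := by
    filter_upwards [self_mem_nhdsWithin] with r (hr : 0 < r)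
    rw [Real.rpow_neg hr.le, ← div_eq_mul_inv, ← Real.div_rpow hα.le hr.le]
    exact RWRE.integral_powExp_le hτ hα.le hr
  obtain ⟨o, ho, h_eq⟩ := RWRE.exists_eq_one_div_rpow_add (Real.rpow_pos_of_pos hα α) hupper
    fun β hβ => RWRE.exists_eventually_rpow_neg_le_integral_annealedLaw
      h_indep h_ident h_ellip h_rec h_var hα.le hβ
  refine ⟨o, ho, ?_⟩
  filter_upwards [h_eq, self_mem_nhdsWithin] with r hr hr0
  exact ⟨RWRE.integrable_powExp hτ hα.le hr0, hr⟩
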